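/- Let $\mathbb{D}=\{z\in\mathbb{C}:|z|<1\}$, and let $H^2$ be the space of all holomorphic functions $f$ on $\mathbb{D}$ with $\sup_{0\le r<1}\left(\frac{1}{2\pi}\int_0^{2\pi}|f(re^{it})|^2\,dt\right)^{1/2}<\infty$. Let $\varphi:\mathbb{D}\to\mathbb{D}$ be holomorphic and let $w\in\mathbb{D}$ satisfy $\varphi(w)=w$. Let $\theta$ be an inner function, that is, a holomorphic function on $\mathbb{D}$ with $|\theta(z)|\le 1$ for all $z\in\mathbb{D}$ whose radial limit $\lim_{r\to1^-}\theta(re^{it})$ exists and has modulus one for almost every $t\in[0,2\pi)$. Suppose that $\theta(w)\ne 0$. Put $\theta H^2=\{\theta g:g\in H^2\}$ and $C_\varphi f=f\circ\varphi$. Then $C_\varphi(\theta H^2)\subseteq\theta H^2$ if and only if $\theta\circ\varphi=\theta$ on $\mathbb{D}$. -/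

import Mathlib

namespace BeurlingComposition

/-- The open unit disc `𝔻` in `ℂ`. Functions on the disc are represented by functions
`ℂ → ℂ`, of which only the values on `disc` are ever used. -/
def disc : Set ℂ := Metric.ball 0 1

/-- `φ` is a holomorphic self-map of the open unit disc. -/
structure IsHolomorphicSelfMap (φ : ℂ → ℂ) : Prop where
  differentiableOn : DifferentiableOn ℂ φ disc
  mapsTo : Set.MapsTo φ disc disc

/-- The integral mean `((1 / 2π) ∫₀^{2π} |f (r e^{it})|² dt)^{1/2}`. -/
noncomputable def integralMean (f : ℂ → ℂ) (r : ℝ) : ℝ :=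
  √((1 / (2 * Real.pi)) *
    ∫ t in (0 : ℝ)..(2 * Real.pi), ‖f ((r : ℂ) * Complex.exp ((t : ℂ) * Complex.I))‖ ^ 2)

/-- The Hardy space `H²`: the functions holomorphic in the disc whose integral means over
`0 ≤ r < 1` have a finite supremum. -/
def hardyTwo : Set (ℂ → ℂ) :=
  {f | DifferentiableOn ℂ f disc ∧ BddAbove (integralMean f '' Set.Ico 0 1)}

/-- `θ` is an inner function: holomorphic in the disc, bounded by one in modulus there, and
for almost every `t ∈ [0, 2π)` the radial limit of `θ` at `e^{it}` exists and has modulus one. -/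
structure IsInner (θ : ℂ → ℂ) : Prop where
  differentiableOn : DifferentiableOn ℂ θ disc
  norm_le_one : ∀ z ∈ disc, ‖θ z‖ ≤ 1
  radial_limit : ∀ᵐ t : ℝ ∂(MeasureTheory.volume.restrict (Set.Ico 0 (2 * Real.pi))),
    ∃ ζ : ℂ, ‖ζ‖ = 1 ∧
      Filter.Tendsto (fun r : ℝ => θ ((r : ℂ) * Complex.exp ((t : ℂ) * Complex.I)))
        (nhdsWithin 1 (Set.Iio 1)) (nhds ζ)

/-- The space `θ H² = {θ g : g ∈ H²}`, as a set of functions on the disc. -/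
def beurlingSubspace (θ : ℂ → ℂ) : Set (ℂ → ℂ) :=
  {f | ∃ g ∈ hardyTwo, Set.EqOn f (fun z => θ z * g z) disc}

/-- The composition operator `C_φ f = f ∘ φ`. -/
def compositionOperator (φ : ℂ → ℂ) (f : ℂ → ℂ) : ℂ → ℂ := f ∘ φ

end BeurlingComposition

namespace BeurlingComposition

open Filter Topology Metric Complex MeasureTheory Real

/-! If `θ H²` is invariant, then `θ = θ · 1` gives `θ ∘ φ = θ h` with `h` in `H²`. Since `|θ h| ≤ 1`
and `|θ| = 1` almost everywhere on the boundary, `|h| ≤ 1` in the disc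
(`norm_le_one_of_norm_inner_mul_le_one`). The fixed point and `θ w ≠ 0` give `h w = 1`, so `h` is
constant by the maximum principle. Conversely, `(θ g) ∘ φ = θ (g ∘ φ)`, and `g ∘ φ` is in `H²` by
Littlewood subordination (`comp_mem_hardyTwo`). Both analytic facts are proved with Poisson
integrals over circles of radius `R < 1`, so boundary values of `H²` functions are never needed. -/

lemma integralMean_eq_sqrt_circleAverage (f : ℂ → ℂ) (r : ℝ) :
    integralMean f r = √(circleAverage (fun z => ‖f z‖ ^ 2) 0 r) := by
  simp [integralMean, circleAverage, circleMap]

lemma circleAverage_norm_sq_nonneg (f : ℂ → ℂ) (r : ℝ) :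
    0 ≤ circleAverage (fun z => ‖f z‖ ^ 2) 0 r :=
  circleAverage_nonneg_of_nonneg fun _ _ => by positivity

lemma mem_hardyTwo_iff {f : ℂ → ℂ} :
    f ∈ hardyTwo ↔ DifferentiableOn ℂ f disc ∧
      ∃ M, ∀ r ∈ Set.Ico (0 : ℝ) 1, circleAverage (fun z => ‖f z‖ ^ 2) 0 r ≤ M := by
  refine and_congr_right fun _ => ⟨?_, ?_⟩
  · rintro ⟨M, hM⟩
    refine ⟨M ^ 2, fun r hr => ?_⟩
    have h := hM ⟨r, hr, rfl⟩
    rw [integralMean_eq_sqrt_circleAverage] at h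
    exact (Real.sqrt_le_iff.1 h).2
  · rintro ⟨M, hM⟩
    refine ⟨√M, ?_⟩
    rintro _ ⟨r, hr, rfl⟩
    rw [integralMean_eq_sqrt_circleAverage]
    exact Real.sqrt_le_sqrt (hM r hr)

lemma const_mem_hardyTwo (c : ℂ) : (fun _ => c) ∈ hardyTwo :=
  mem_hardyTwo_iff.2 ⟨differentiableOn_const c, ‖c‖ ^ 2, fun _ _ => (circleAverage_const _ _ _).le⟩

lemma closedBall_subset_disc {R : ℝ} (hR : R < 1) : closedBall (0 : ℂ) R ⊆ disc :=
  closedBall_subset_ball hR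

lemma diffContOnCl_ball {f : ℂ → ℂ} (hf : DifferentiableOn ℂ f disc) {R : ℝ} (hR : R < 1) :
    DiffContOnCl ℂ f (ball 0 R) :=
  (hf.mono (closure_ball_subset_closedBall.trans (closedBall_subset_disc hR))).diffContOnCl

lemma continuousOn_sphere {f : ℂ → ℂ} (hf : DifferentiableOn ℂ f disc) {R : ℝ} (hR : R < 1) :
    ContinuousOn f (sphere 0 R) :=
  hf.continuousOn.mono (sphere_subset_closedBall.trans (closedBall_subset_disc hR))

/-! ### Poisson kernel estimates -/

lemma continuousOn_poissonKernel_sphere {z : ℂ} {R : ℝ} (hz : z ∈ ball (0 : ℂ) R) :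
    ContinuousOn (poissonKernel 0 z) (sphere 0 R) := by
  have h := continuousOn_herglotzRieszKernel_sphere (c := 0) hz
  rw [abs_of_pos (pos_of_mem_ball hz)] at h
  rw [poissonKernel_eq_re_herglotzRieszKernel]
  exact continuous_re.comp_continuousOn h

lemma poissonKernel_nonneg {z ζ : ℂ} {R : ℝ} (hz : z ∈ ball (0 : ℂ) R)
    (hζ : ζ ∈ sphere (0 : ℂ) R) : 0 ≤ poissonKernel 0 z ζ := by
  rw [mem_ball_zero_iff] at hz
  rw [mem_sphere_zero_iff_norm] at hζ
  rw [poissonKernel_def]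
  simp only [sub_zero, hζ]
  have : ‖z‖ ^ 2 ≤ R ^ 2 := by gcongr
  exact div_nonneg (sub_nonneg.2 this) (by positivity)

lemma poissonKernel_le {z ζ : ℂ} {R : ℝ} (hz : z ∈ ball (0 : ℂ) R)
    (hζ : ζ ∈ sphere (0 : ℂ) R) : poissonKernel 0 z ζ ≤ (R + ‖z‖) / (R - ‖z‖) := by
  have h := re_herglotzRieszKernel_le hζ hz
  rw [poissonKernel_eq_re_herglotzRieszKernel]
  simpa [herglotzRieszKernel_def] using h

/-- The bound of the Poisson kernel is uniform for radii bounded away from `‖z‖`. -/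
lemma add_div_sub_le {a R ρ : ℝ} (ha : 0 ≤ a) (haρ : a < ρ) (hρ : ρ ≤ R) (hR : R ≤ 1) :
    (R + a) / (R - a) ≤ (1 + a) / (ρ - a) := by
  have : 0 < ρ - a := sub_pos.2 haρ
  gcongr

/-- Averages against the Poisson kernel of a nonnegative function are controlled by its circle
average. -/
lemma circleAverage_poissonKernel_mul_le {g : ℂ → ℝ} {z : ℂ} {R : ℝ} (hz : z ∈ ball (0 : ℂ) R)
    (hg : ContinuousOn g (sphere 0 R)) (hg0 : ∀ ζ ∈ sphere (0 : ℂ) R, 0 ≤ g ζ) :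
    circleAverage (fun ζ => poissonKernel 0 z ζ * g ζ) 0 R
      ≤ (R + ‖z‖) / (R - ‖z‖) * circleAverage g 0 R := by
  have hR := pos_of_mem_ball hz
  have hcg : ContinuousOn (fun ζ => ((R + ‖z‖) / (R - ‖z‖)) • g ζ) (sphere 0 R) :=
    hg.const_smul ((R + ‖z‖) / (R - ‖z‖))
  rw [← smul_eq_mul (a := (R + ‖z‖) / (R - ‖z‖)), ← circleAverage_fun_smul]
  refine circleAverage_mono
    (((continuousOn_poissonKernel_sphere hz).mul hg).circleIntegrable hR.le)
    (hcg.circleIntegrable hR.le) fun ζ hζ => ?_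
  rw [abs_of_pos hR] at hζ
  exact mul_le_mul_of_nonneg_right (poissonKernel_le hz hζ) (hg0 ζ hζ)

lemma norm_circleAverage_le (f : ℂ → ℂ) (R : ℝ) :
    ‖circleAverage f 0 R‖ ≤ circleAverage (fun ζ => ‖f ζ‖) 0 R := by
  rw [circleAverage, circleAverage, norm_smul, smul_eq_mul, Real.norm_of_nonneg (by positivity)]
  gcongr
  exact intervalIntegral.norm_integral_le_integral_norm two_pi_pos.le

/-- The modulus of a holomorphic function is bounded by the Poisson integral of its modulus. -/
lemma norm_le_circleAverage_poissonKernel {f : ℂ → ℂ} {z : ℂ} {R : ℝ}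
    (hf : DiffContOnCl ℂ f (ball 0 R)) (hz : z ∈ ball (0 : ℂ) R) :
    ‖f z‖ ≤ circleAverage (fun ζ => poissonKernel 0 z ζ * ‖f ζ‖) 0 R := by
  have hR := pos_of_mem_ball hz
  rw [← hf.circleAverage_poissonKernel_smul hz]
  refine (norm_circleAverage_le _ _).trans_eq (circleAverage_congr_sphere fun ζ hζ => ?_)
  rw [abs_of_pos hR] at hζ
  simp [abs_of_nonneg (poissonKernel_nonneg hz hζ)]

/-- The square of `f` is again holomorphic, so the bound for the modulus applies to it. -/
lemma norm_sq_le_circleAverage_poissonKernel {f : ℂ → ℂ} {z : ℂ} {R : ℝ}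
    (hf : DiffContOnCl ℂ f (ball 0 R)) (hz : z ∈ ball (0 : ℂ) R) :
    ‖f z‖ ^ 2 ≤ circleAverage (fun ζ => poissonKernel 0 z ζ * ‖f ζ‖ ^ 2) 0 R := by
  simpa [norm_smul, sq] using norm_le_circleAverage_poissonKernel (hf.smul hf) hz

lemma circleAverage_poissonKernel {z : ℂ} {R : ℝ} (hz : z ∈ ball (0 : ℂ) R) :
    circleAverage (poissonKernel 0 z) 0 R = 1 := by
  have hR := pos_of_mem_ball hz
  have h := (diffContOnCl_const (c := (1 : ℂ))).circleAverage_poissonKernel_smul hz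
  have h2 := ofRealCLM.circleAverage_comp_comm
    ((continuousOn_poissonKernel_sphere hz).circleIntegrable hR.le)
  have h3 : (ofRealCLM ∘ poissonKernel 0 z) = (poissonKernel 0 z • fun _ : ℂ => (1 : ℂ)) := by
    ext ζ; simp
  rw [h3, h] at h2
  exact ofReal_injective h2.symm

/-! ### Littlewood subordination -/

/-- The composition operator of a holomorphic self-map of the disc maps `H²` into itself. -/
theorem comp_mem_hardyTwo {f φ : ℂ → ℂ} (hφ : IsHolomorphicSelfMap φ) (hf : f ∈ hardyTwo) :
    f ∘ φ ∈ hardyTwo := by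
  obtain ⟨hfd, M, hM⟩ := mem_hardyTwo_iff.1 hf
  refine mem_hardyTwo_iff.2 ⟨hfd.comp hφ.differentiableOn hφ.mapsTo, ?_⟩
  set a : ℝ := ‖φ 0‖
  have ha : a < 1 := mem_ball_zero_iff.1 (hφ.mapsTo (mem_ball_self one_pos))
  have ha0 : 0 ≤ a := norm_nonneg _
  refine ⟨(1 + a) / ((1 + a) / 2 - a) * M, fun r hr => ?_⟩
  -- Keeping `R` at or above the midpoint of `a` and `1` bounds the Poisson kernel at `φ 0`
  -- independently of `r`.
  obtain ⟨R, hR1, haR, hRφ⟩ : ∃ R < 1, (1 + a) / 2 ≤ R ∧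
      Set.MapsTo φ (closedBall 0 r) (ball 0 R) := by
    obtain ⟨z₀, hz₀, hmax⟩ := (isCompact_closedBall (0 : ℂ) r).exists_isMaxOn
      ⟨0, mem_closedBall_self hr.1⟩
      ((hφ.differentiableOn.continuousOn.mono (closedBall_subset_disc hr.2)).norm)
    have h₀ : ‖φ z₀‖ < 1 := mem_ball_zero_iff.1 (hφ.mapsTo (closedBall_subset_disc hr.2 hz₀))
    obtain ⟨R, hR, hR1⟩ := exists_between (max_lt h₀ (by linarith : (1 + a) / 2 < 1))
    exact ⟨R, hR1, ((le_max_right _ _).trans_lt hR).le, fun z hz =>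
      mem_ball_zero_iff.2 ((hmax hz).trans_lt ((le_max_left _ _).trans_lt hR))⟩
  have hφ0 : φ 0 ∈ ball (0 : ℂ) R := hRφ (mem_closedBall_self hr.1)
  have hR0 : 0 < R := pos_of_mem_ball hφ0
  have hcf : ContinuousOn (fun ζ => ‖f ζ‖ ^ 2) (sphere 0 R) :=
    (continuousOn_sphere hfd hR1).norm.pow 2
  have hif : CircleIntegrable (fun ζ => ‖f ζ‖ ^ 2) 0 R := hcf.circleIntegrable hR0.le
  have hifc : CircleIntegrable (fun ζ => ((‖f ζ‖ ^ 2 : ℝ) : ℂ)) 0 R :=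
    (continuous_ofReal.comp_continuousOn hcf).circleIntegrable hR0.le
  -- The real part of `G` is a harmonic majorant of `|f|²`; as `G ∘ φ` is holomorphic, the mean
  -- value property evaluates its average at `φ 0`.
  set G : ℂ → ℂ := fun z =>
    circleAverage (fun ζ => herglotzRieszKernel 0 z ζ • ((‖f ζ‖ ^ 2 : ℝ) : ℂ)) 0 R with hG
  have hGre : ∀ z ∈ ball (0 : ℂ) R,
      (G z).re = circleAverage (fun ζ => poissonKernel 0 z ζ * ‖f ζ‖ ^ 2) 0 R := by
    intro z hz
    rw [hG, re_circleAverage_herglotzRieszKernel_smul hif hz,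
      ← poissonKernel_eq_re_herglotzRieszKernel]
    rfl
  have hGd : DifferentiableOn ℂ G (ball 0 R) :=
    differentiableOn_circleAverage_herglotzRieszKernel_smul hifc
  have hφr : DifferentiableOn ℂ φ (closedBall 0 r) :=
    hφ.differentiableOn.mono (closedBall_subset_disc hr.2)
  have hGφ : DifferentiableOn ℂ (G ∘ φ) (closedBall 0 r) := hGd.comp hφr hRφ
  have hsc : sphere (0 : ℂ) r ⊆ closedBall 0 r := sphere_subset_closedBall
  have hGi : CircleIntegrable (G ∘ φ) 0 r := (hGφ.continuousOn.mono hsc).circleIntegrable hr.1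
  have hmean : circleAverage (reCLM ∘ (G ∘ φ)) 0 r = (G (φ 0)).re := by
    rw [reCLM.circleAverage_comp_comm hGi]
    have hd : DiffContOnCl ℂ (G ∘ φ) (ball 0 |r|) := by
      rw [abs_of_nonneg hr.1]
      exact (hGφ.mono closure_ball_subset_closedBall).diffContOnCl
    rw [hd.circleAverage]
    rfl
  calc circleAverage (fun z => ‖(f ∘ φ) z‖ ^ 2) 0 r
      ≤ circleAverage (reCLM ∘ (G ∘ φ)) 0 r := by
        refine circleAverage_mono (ContinuousOn.circleIntegrable hr.1 ?_)
          (ContinuousOn.circleIntegrable hr.1 ?_) fun z hz => ?_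
        · exact ((hfd.comp hφ.differentiableOn hφ.mapsTo).continuousOn.mono
            (hsc.trans (closedBall_subset_disc hr.2))).norm.pow 2
        · exact reCLM.continuous.comp_continuousOn (hGφ.continuousOn.mono hsc)
        · rw [abs_of_nonneg hr.1] at hz
          have hz' := hRφ (hsc hz)
          exact (norm_sq_le_circleAverage_poissonKernel (diffContOnCl_ball hfd hR1) hz').trans_eq
            (hGre _ hz').symm
    _ = circleAverage (fun ζ => poissonKernel 0 (φ 0) ζ * ‖f ζ‖ ^ 2) 0 R := by
        rw [hmean, hGre _ hφ0]
    _ ≤ (R + a) / (R - a) * circleAverage (fun ζ => ‖f ζ‖ ^ 2) 0 R :=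
        circleAverage_poissonKernel_mul_le hφ0 hcf fun _ _ => by positivity
    _ ≤ (1 + a) / ((1 + a) / 2 - a) * M := by
        refine mul_le_mul (add_div_sub_le ha0 (by linarith) haR hR1.le) (hM R ⟨hR0.le, hR1⟩)
          (circleAverage_norm_sq_nonneg f R) (div_nonneg (by linarith) (by linarith))

/-! ### Division by an inner function -/

/-- Above height `ε⁻¹` one has `x ≤ ε x²`, so the `H²` bound absorbs the part lost by truncation. -/
lemma max_sub_one_le {x ε : ℝ} (hx : 0 ≤ x) (hε : 0 < ε) :
    max (x - 1) 0 ≤ ε * x ^ 2 + min (max (x - 1) 0) ε⁻¹ := by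
  rcases le_total (max (x - 1) 0) ε⁻¹ with h | h
  · rw [min_eq_left h]
    nlinarith [mul_nonneg hε.le (sq_nonneg x)]
  · rw [min_eq_right h]
    have h1 : ε⁻¹ ≤ x := h.trans (max_le (by linarith) hx)
    have h2 : 1 ≤ ε * x := by
      calc 1 = ε * ε⁻¹ := (mul_inv_cancel₀ hε.ne').symm
        _ ≤ ε * x := by gcongr
    have h3 : max (x - 1) 0 ≤ x := max_le (by linarith) hx
    have h4 : 0 < ε⁻¹ := inv_pos.2 hε
    nlinarith

/-- Along almost every radius `|h| ≤ 1 / |θ| → 1`. Truncating at `K` supplies the constant that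
dominates the integrands. -/
lemma tendsto_circleAverage_min_of_norm_mul_le_one {θ h : ℂ → ℂ} (hθ : IsInner θ)
    (hh : DifferentiableOn ℂ h disc) (hb : ∀ z ∈ disc, ‖θ z * h z‖ ≤ 1) {K : ℝ} (hK : 0 ≤ K) :
    Tendsto (fun R : ℝ => circleAverage (fun ζ => min (max (‖h ζ‖ - 1) 0) K) 0 R)
      (𝓝[<] 1) (𝓝 0) := by
  have hmem : ∀ᶠ R : ℝ in 𝓝[<] 1, R ∈ Set.Ioo (0 : ℝ) 1 := Ioo_mem_nhdsLT one_pos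
  have hlim : Tendsto (fun R : ℝ =>
      ∫ t in (0 : ℝ)..2 * π, min (max (‖h (circleMap 0 R t)‖ - 1) 0) K) (𝓝[<] 1)
      (𝓝 (∫ _ in (0 : ℝ)..2 * π, (0 : ℝ))) := by
    refine intervalIntegral.tendsto_integral_filter_of_dominated_convergence (fun _ => K) ?_ ?_
      intervalIntegrable_const ?_
    · filter_upwards [hmem] with R hR
      have hc : Continuous fun t : ℝ => h (circleMap 0 R t) :=
        (continuousOn_sphere hh hR.2).comp_continuous (continuous_circleMap 0 R)
          fun t => circleMap_mem_sphere 0 hR.1.le t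
      exact (((hc.norm.sub continuous_const).max continuous_const).min
        continuous_const).aestronglyMeasurable
    · refine Eventually.of_forall fun R => Eventually.of_forall fun t _ => ?_
      rw [Real.norm_of_nonneg (le_min (le_max_right _ _) hK)]
      exact min_le_right _ _
    · have hr := hθ.radial_limit
      rw [Measure.restrict_congr_set Ico_ae_eq_Ioc, ae_restrict_iff' measurableSet_Ioc] at hr
      filter_upwards [hr] with t ht htm
      rw [Set.uIoc_of_le two_pi_pos.le] at htm
      obtain ⟨ζ, hζ, hlim⟩ := ht htm
      have hn : Tendsto (fun R : ℝ => ‖θ (circleMap 0 R t)‖) (𝓝[<] 1) (𝓝 1) := by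
        simpa [circleMap, hζ] using hlim.norm
      have hinv : Tendsto (fun R : ℝ => max (‖θ (circleMap 0 R t)‖⁻¹ - 1) 0) (𝓝[<] 1) (𝓝 0) := by
        simpa using ((hn.inv₀ one_ne_zero).sub_const 1).max (tendsto_const_nhds (x := (0 : ℝ)))
      refine tendsto_of_tendsto_of_tendsto_of_le_of_le' tendsto_const_nhds hinv
        (Eventually.of_forall fun R => le_min (le_max_right _ _) hK) ?_
      filter_upwards [hmem, hn.eventually (lt_mem_nhds one_pos)] with R hR hpos
      refine (min_le_left _ _).trans (max_le_max (sub_le_sub_right ?_ 1) le_rfl)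
      have hb' := hb _ (closedBall_subset_disc hR.2
        (circleMap_mem_closedBall (0 : ℂ) hR.1.le t))
      rw [norm_mul] at hb'
      rw [← one_div, le_div_iff₀' hpos]
      exact hb'
  simpa [circleAverage] using hlim.const_mul ((2 * π)⁻¹)

/-- Division by an inner function: a quotient in `H²` of a function bounded by one by an inner
function is bounded by one. -/
theorem norm_le_one_of_norm_inner_mul_le_one {θ h : ℂ → ℂ} (hθ : IsInner θ) (hh : h ∈ hardyTwo)
    (hb : ∀ z ∈ disc, ‖θ z * h z‖ ≤ 1) {z : ℂ} (hz : z ∈ disc) : ‖h z‖ ≤ 1 := by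
  obtain ⟨hd, M, hM⟩ := mem_hardyTwo_iff.1 hh
  have hz1 : ‖z‖ < 1 := mem_ball_zero_iff.1 hz
  have hz0 := norm_nonneg z
  set C : ℝ := (1 + ‖z‖) / ((1 + ‖z‖) / 2 - ‖z‖)
  have hC : 0 ≤ C := div_nonneg (by linarith) (by linarith)
  -- For fixed `ε` the radius `R` tends to `1`, which removes the truncated term; only afterwards
  -- does `ε` tend to `0`.
  have key : ∀ ε > 0, ‖h z‖ ≤ 1 + C * (ε * M) := by
    intro ε hε
    have hl := ((tendsto_circleAverage_min_of_norm_mul_le_one hθ hd hb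
      (inv_nonneg.2 hε.le)).const_add (ε * M)).const_mul C |>.const_add 1
    rw [add_zero] at hl
    refine ge_of_tendsto hl ?_
    filter_upwards [Ioo_mem_nhdsLT (by linarith : (1 + ‖z‖) / 2 < 1)] with R hR
    have hzR : z ∈ ball (0 : ℂ) R := mem_ball_zero_iff.2 (by linarith [hR.1])
    have hR0 : 0 < R := pos_of_mem_ball hzR
    have hc : ContinuousOn h (sphere 0 R) := continuousOn_sphere hd hR.2
    have hP := continuousOn_poissonKernel_sphere hzR
    have hcm : ContinuousOn (fun ζ => max (‖h ζ‖ - 1) 0) (sphere 0 R) :=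
      ContinuousOn.sup (hc.norm.sub continuousOn_const) continuousOn_const
    have hPm : ContinuousOn (fun ζ => poissonKernel 0 z ζ * max (‖h ζ‖ - 1) 0) (sphere 0 R) :=
      hP.mul hcm
    have hcs : ContinuousOn (fun ζ => ε • ‖h ζ‖ ^ 2) (sphere 0 R) := (hc.norm.pow 2).const_smul ε
    have hcmin : ContinuousOn (fun ζ => min (max (‖h ζ‖ - 1) 0) ε⁻¹) (sphere 0 R) :=
      ContinuousOn.inf hcm continuousOn_const
    -- Uses `|h| ≤ 1 + max (|h| - 1) 0` and the unit mass of the kernel.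
    have hsplit : circleAverage (fun ζ => poissonKernel 0 z ζ * ‖h ζ‖) 0 R
        ≤ 1 + circleAverage (fun ζ => poissonKernel 0 z ζ * max (‖h ζ‖ - 1) 0) 0 R := by
      nth_rewrite 1 [← circleAverage_poissonKernel hzR]
      rw [← circleAverage_fun_add (hP.circleIntegrable hR0.le)
        (hPm.circleIntegrable hR0.le)]
      refine circleAverage_mono ((hP.mul hc.norm).circleIntegrable hR0.le)
        ((hP.add hPm).circleIntegrable hR0.le) fun ζ hζ => ?_
      rw [abs_of_pos hR0] at hζ
      nlinarith [poissonKernel_nonneg hzR hζ, le_max_left (‖h ζ‖ - 1) 0]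
    have hbound : circleAverage (fun ζ => max (‖h ζ‖ - 1) 0) 0 R
        ≤ ε * M + circleAverage (fun ζ => min (max (‖h ζ‖ - 1) 0) ε⁻¹) 0 R := by
      have hε' : circleAverage (fun ζ => ε • ‖h ζ‖ ^ 2) 0 R ≤ ε * M := by
        rw [circleAverage_fun_smul, smul_eq_mul]
        exact mul_le_mul_of_nonneg_left (hM R ⟨hR0.le, hR.2⟩) hε.le
      refine le_trans ?_ (add_le_add_left hε' _)
      rw [← circleAverage_fun_add (hcs.circleIntegrable hR0.le) (hcmin.circleIntegrable hR0.le)]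
      exact circleAverage_mono (hcm.circleIntegrable hR0.le)
        ((hcs.add hcmin).circleIntegrable hR0.le)
        fun ζ _ => max_sub_one_le (norm_nonneg _) hε
    have hnn : 0 ≤ circleAverage (fun ζ => max (‖h ζ‖ - 1) 0) 0 R :=
      circleAverage_nonneg_of_nonneg fun _ _ => le_max_right _ _
    calc ‖h z‖ ≤ 1 + circleAverage (fun ζ => poissonKernel 0 z ζ * max (‖h ζ‖ - 1) 0) 0 R :=
          (norm_le_circleAverage_poissonKernel (diffContOnCl_ball hd hR.2) hzR).trans hsplit
      _ ≤ 1 + C * circleAverage (fun ζ => max (‖h ζ‖ - 1) 0) 0 R := by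
          gcongr
          exact (circleAverage_poissonKernel_mul_le hzR hcm fun _ _ => le_max_right _ _).trans
            (mul_le_mul_of_nonneg_right
              (add_div_sub_le hz0 (by linarith) hR.1.le hR.2.le) hnn)
      _ ≤ _ := by gcongr
  have hlim : Tendsto (fun ε : ℝ => 1 + C * (ε * M)) (𝓝[>] 0) (𝓝 1) := by
    have : Continuous fun ε : ℝ => 1 + C * (ε * M) := by fun_prop
    simpa using (this.tendsto 0).mono_left nhdsWithin_le_nhds
  exact ge_of_tendsto hlim (by filter_upwards [self_mem_nhdsWithin] with ε hε using key ε hε)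

end BeurlingComposition

open BeurlingComposition in
theorem corollary3p4 (φ θ : ℂ → ℂ) (w : ℂ)
    (hφ : BeurlingComposition.IsHolomorphicSelfMap φ)
    (hw : w ∈ BeurlingComposition.disc) (hfix : φ w = w)
    (hθ : BeurlingComposition.IsInner θ) (hθw : θ w ≠ 0) :
    BeurlingComposition.compositionOperator φ '' BeurlingComposition.beurlingSubspace θ
        ⊆ BeurlingComposition.beurlingSubspace θ ↔
      Set.EqOn (θ ∘ φ) θ BeurlingComposition.disc := by
  constructor
  · intro hsub
    obtain ⟨h, hh, hEq⟩ := hsub ⟨θ, ⟨_, const_mem_hardyTwo 1, fun z _ => (mul_one _).symm⟩, rfl⟩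
    have hval : ∀ z ∈ disc, θ (φ z) = θ z * h z := hEq
    have hle : ∀ z ∈ disc, ‖h z‖ ≤ 1 := fun z hz =>
      norm_le_one_of_norm_inner_mul_le_one hθ hh
        (fun z hz => hval z hz ▸ hθ.norm_le_one _ (hφ.mapsTo hz)) hz
    have hw1 : h w = 1 := by
      have := hval w hw
      rw [hfix] at this
      exact mul_left_cancel₀ hθw (by rw [← this, mul_one])
    have hconst := Complex.eqOn_of_isPreconnected_of_isMaxOn_norm
      (convex_ball (0 : ℂ) 1).isPreconnected Metric.isOpen_ball hh.1 hw
      (fun z hz => by simpa [hw1] using hle z hz)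
    intro z hz
    have hz1 : h z = 1 := (hconst hz).trans hw1
    rw [Function.comp_apply, hval z hz, hz1, mul_one]
  · rintro hinv _ ⟨f, ⟨g, hg, hfg⟩, rfl⟩
    refine ⟨g ∘ φ, comp_mem_hardyTwo hφ hg, fun z hz => ?_⟩
    have h := hfg (hφ.mapsTo hz)
    have h2 : θ (φ z) = θ z := hinv hz
    exact h.trans (congrArg (· * g (φ z)) h2)
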